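/- Let $\omega_1$ be the first uncountable ordinal with its order topology, and for a topological space $X$ let $\mathcal{K}(X)$ be the set of all compact subsets of $X$, ordered by inclusion. For directed partially ordered sets $P$ and $Q$ write $P \ge_T Q$ if there is a map $\phi : P \to Q$ that carries every cofinal subset of $P$ to a cofinal subset of $Q$. Let $S \subseteq \omega_1$ carry the subspace topology, and let $\overline{S}$ be the closure of $S$ in $\omega_1$. Then there exists a separable metrizable space $M$ with $\mathcal{K}(M) \ge_T \mathcal{K}(S)$ if and only if $\overline{S} \setminus S$ is bounded in $\omega_1$. -/

import Mathlib

open TopologicalSpace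

universe u v

/-- The first uncountable ordinal `ω₁`, as the space of all countable ordinals with the topology
induced from the ordinals (this is its order topology, see `Omega1.orderTopology`). -/
abbrev Omega1 : Type (u + 1) := Set.Iio (Ordinal.omega.{u} 1)

/-- The topology on `Omega1` is the order topology. -/
theorem Omega1.orderTopology : OrderTopology Omega1.{u} := inferInstance

/-- `TukeyGE P Q` is the relation `P ≥_T Q`: there is a Tukey quotient from `P` to `Q`, that is,
a map (not required to be monotone) carrying cofinal subsets of `P` to cofinal subsets of `Q`.
It is meant for directed partially ordered sets. -/
def TukeyGE (P : Type u) (Q : Type v) [PartialOrder P] [PartialOrder Q] : Prop :=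
  ∃ φ : P → Q, ∀ C : Set P, IsCofinal C → IsCofinal (φ '' C)

/-- `CompactsPoset X` is `𝒦(X)`: the compact subsets of `X` (including the empty set),
ordered by inclusion. -/
abbrev CompactsPoset (X : Type u) [TopologicalSpace X] : Type u := Compacts X

/-- The order on `𝒦(X)` is inclusion of the underlying sets. -/
theorem CompactsPoset.le_iff {X : Type u} [TopologicalSpace X] (K L : CompactsPoset X) :
    K ≤ L ↔ (K : Set X) ⊆ (L : Set X) := Iff.rfl

open Set Filter Topology

/-! A Tukey quotient amounts to maps `φ`, `ψ` with `ψ q ≤ p → q ≤ φ p`.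

Sufficiency: if `closure S \ S` lies below `α`, a compact subset of `S` is controlled by its trace
on `Iic α`, a countable metrizable space, and by an upper bound in `ω₁`. So `M` is the sum of `S ∩
Iic α` and the space of well-ordered sets of rationals, whose compact subsets have bounded order
types.

Necessity: a countable base of `M` yields countably many sets `C n ⊆ S` that approximate every
compact subset of `S`. If `E = closure S \ S` were unbounded, one could diagonalise: a sequence in
`S` converging within `S` has its `n`th term outside `C n` whenever unboundedly many points of `E`
are not limits of `C n` from below. With its limit it is a compact set that the `C n` fail to
approximate. -/

theorem tukeyGE_iff_exists {P : Type u} {Q : Type v} [PartialOrder P] [PartialOrder Q] :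
    TukeyGE P Q ↔ ∃ (φ : P → Q) (ψ : Q → P), ∀ p q, ψ q ≤ p → q ≤ φ p := by
  constructor
  · rintro ⟨φ, hφ⟩
    -- Otherwise the failures `f p ≥ p` form a cofinal set whose image has no element above `q`.
    have h : ∀ q, ∃ p, ∀ p', p ≤ p' → q ≤ φ p' := by
      intro q
      by_contra! h
      choose f hf hq using h
      obtain ⟨_, ⟨_, ⟨p, rfl⟩, rfl⟩, hp⟩ :=
        hφ (range f) (fun p => ⟨f p, mem_range_self p, hf p⟩) q
      exact hq p hp
    choose ψ hψ using h
    exact ⟨φ, ψ, fun p q => hψ q p⟩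
  · rintro ⟨φ, ψ, h⟩
    refine ⟨φ, fun C hC q => ?_⟩
    obtain ⟨p, hp, hle⟩ := hC (ψ q)
    exact ⟨φ p, mem_image_of_mem φ hp, h p q hle⟩

/-! ### Countable bounds and compact initial segments in `ω₁` -/

namespace Omega1

theorem exists_forall_lt {ι : Type*} [Countable ι] (f : ι → Omega1.{u}) : ∃ b, ∀ i, f i < b := by
  have hs : ∀ i, Order.succ (f i).1 < Ordinal.omega 1 := fun i =>
    (Cardinal.isSuccLimit_omega 1).succ_lt (f i).2
  refine ⟨⟨⨆ i, Order.succ (f i).1, Ordinal.iSup_lt_omega_one hs⟩, fun i => ?_⟩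
  have hb : BddAbove (range fun i => Order.succ (f i).1) :=
    ⟨Ordinal.omega 1, by rintro _ ⟨i, rfl⟩; exact (hs i).le⟩
  exact Subtype.coe_lt_coe.1 ((Order.lt_succ _).trans_le (le_ciSup hb i))

theorem exists_gt' (a : Omega1.{u}) : ∃ b, a < b :=
  (exists_forall_lt fun _ : Unit => a).imp fun _ h => h ()

instance : Nonempty Omega1.{u} := (exists_forall_lt (Empty.elim : Empty → Omega1.{u})).nonempty

instance (a : Omega1.{u}) : Countable (Iio a) := by
  have h : Countable (Iio a.1) := by
    rw [← Cardinal.mk_le_aleph0_iff, Cardinal.mk_Iio_ordinal, Cardinal.lift_le_aleph0,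
      ← Cardinal.lt_aleph_one_iff]
    exact Cardinal.lt_omega_iff_card_lt.1 a.2
  exact Function.Injective.countable (f := fun x : Iio a => (⟨x.1.1, x.2⟩ : Iio a.1))
    fun x y h => Subtype.ext (Subtype.ext (Subtype.mk.inj h))

instance (a : Omega1.{u}) : Countable (Iic a) := by
  rw [← Iio_union_right]
  exact ((Set.to_countable (Iio a)).union (countable_singleton a)).to_subtype

theorem exists_forall_le_iff_lt (a : Omega1.{u}) : ∃ b, ∀ y, y ≤ a ↔ y < b := by
  obtain ⟨b, hb, hmin⟩ := wellFounded_lt.has_min {b | a < b} (exists_gt' a)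
  exact ⟨b, fun y => ⟨fun h => h.trans_lt hb, fun h => not_lt.1 fun hy => hmin y hy h⟩⟩

theorem isOpen_Iic (a : Omega1.{u}) : IsOpen (Iic a) := by
  obtain ⟨b, hb⟩ := exists_forall_le_iff_lt a
  rw [show Iic a = Iio b from Set.ext hb]
  exact isOpen_Iio

theorem exists_isLUB (s : Set Omega1.{u}) (hs : BddAbove s) : ∃ a, IsLUB s a := by
  obtain ⟨a, ha, hmin⟩ := wellFounded_lt.has_min (upperBounds s) hs
  exact ⟨a, ha, fun b hb => not_lt.1 (hmin b hb)⟩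

theorem isCompact_Iic (a : Omega1.{u}) : IsCompact (Iic a) := by
  rw [Topology.IsInducing.subtypeVal.isCompact_iff]
  convert isCompact_Icc (a := (0 : Ordinal.{u})) (b := a.1) 
  ext x
  simp only [mem_image, mem_Iic, mem_Icc, zero_le, true_and]
  exact ⟨by rintro ⟨y, hy, rfl⟩; exact hy, fun h => ⟨⟨x, h.trans_lt a.2⟩, h, rfl⟩⟩

end Omega1

/-! ### Transfer of a countable base through a Tukey quotient -/

theorem isCompact_union_iUnion {M : Type*} [TopologicalSpace M] {K : Set M} (hK : IsCompact K)
    {L : ℕ → Set M} (hL : ∀ n, IsCompact (L n))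
    (h : ∀ O, IsOpen O → K ⊆ O → ∀ᶠ n in atTop, L n ⊆ O) : IsCompact (K ∪ ⋃ n, L n) := by
  classical
  refine isCompact_of_finite_subcover fun {ι} U hU hcov => ?_
  obtain ⟨t, ht⟩ := hK.elim_finite_subcover U hU (subset_union_left.trans hcov)
  obtain ⟨N, hN⟩ := eventually_atTop.1 (h _ (isOpen_biUnion fun i (_ : i ∈ t) => hU i) ht)
  have hfin : IsCompact (⋃ n ∈ Finset.range N, L n) :=
    (Finset.range N).isCompact_biUnion fun n _ => hL n
  obtain ⟨t', ht'⟩ := hfin.elim_finite_subcover U hU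
    ((iUnion₂_subset fun n _ => (subset_iUnion L n).trans subset_union_right).trans hcov)
  refine ⟨t ∪ t', ?_⟩
  rw [Finset.set_biUnion_union]
  refine union_subset (ht.trans subset_union_left) (iUnion_subset fun n => ?_)
  rcases lt_or_ge n N with hn | hn
  · exact ((subset_biUnion_of_mem (u := L) (Finset.mem_coe.2 (Finset.mem_range.2 hn))).trans
      ht').trans subset_union_right
  · exact (hN n hn).trans subset_union_left

theorem exists_countable_open_between {M : Type*} [TopologicalSpace M]
    [SecondCountableTopology M] :
    ∃ w : ℕ → Set M, (∀ n, IsOpen (w n)) ∧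
      ∀ K O, IsCompact K → IsOpen O → K ⊆ O → ∃ n, K ⊆ w n ∧ w n ⊆ O := by
  have hc : {F : Set (Set M) | F.Finite ∧ F ⊆ countableBasis M}.Countable :=
    countable_ofPred_finite_subset (countable_countableBasis M)
  obtain ⟨f, hf⟩ := hc.exists_eq_range ⟨∅, finite_empty, empty_subset _⟩
  have hmem : ∀ n, (f n).Finite ∧ f n ⊆ countableBasis M := fun n =>
    hf.symm.subset (mem_range_self n)
  refine ⟨fun n => ⋃₀ f n, fun n => isOpen_sUnion fun t ht =>
    isOpen_of_mem_countableBasis ((hmem n).2 ht), fun K O hK hO hKO => ?_⟩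
  suffices h : ∃ F : Set (Set M), (F.Finite ∧ F ⊆ countableBasis M) ∧ K ⊆ ⋃₀ F ∧ ⋃₀ F ⊆ O by
    obtain ⟨F, hF, h⟩ := h
    obtain ⟨n, rfl⟩ := hf.subset hF
    exact ⟨n, h⟩
  refine hK.induction_on (p := fun K => ∃ F : Set (Set M), (F.Finite ∧ F ⊆ countableBasis M) ∧
    K ⊆ ⋃₀ F ∧ ⋃₀ F ⊆ O) ⟨∅, by simp⟩ ?_ ?_ ?_
  · rintro s t hst ⟨F, hF, h1, h2⟩
    exact ⟨F, hF, hst.trans h1, h2⟩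
  · rintro s t ⟨F, hF, h1, h2⟩ ⟨G, hG, h3, h4⟩
    refine ⟨F ∪ G, ⟨hF.1.union hG.1, union_subset hF.2 hG.2⟩, ?_⟩
    rw [sUnion_union]
    exact ⟨union_subset_union h1 h3, union_subset h2 h4⟩
  · intro x hx
    obtain ⟨b, hb, hxb, hbO⟩ := (isBasis_countableBasis M).exists_subset_of_mem_open (hKO hx) hO
    exact ⟨b, mem_nhdsWithin_of_mem_nhds ((isOpen_of_mem_countableBasis hb).mem_nhds hxb),
      {b}, by simpa using ⟨hb, hbO⟩⟩

theorem exists_countable_nhdsSet_sequence {M : Type*} [TopologicalSpace M]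
    [SecondCountableTopology M] :
    ∃ w : ℕ → Set M, ∀ K, IsCompact K → ∃ n : ℕ → ℕ, (∀ k, K ⊆ w (n k)) ∧
      ∀ O, IsOpen O → K ⊆ O → ∀ᶠ k in atTop, w (n k) ⊆ O := by
  obtain ⟨w, hw, h⟩ := exists_countable_open_between (M := M)
  refine ⟨w, fun K hK => ?_⟩
  have hG : ∀ k, ∃ n, K ⊆ w n ∧ w n ⊆ ⋂ j ∈ {j | j ≤ k ∧ K ⊆ w j}, w j := fun k =>
    h K _ hK (((finite_le_nat k).subset fun _ hj => hj.1).isOpen_biInter fun j _ => hw j)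
      (subset_iInter₂ fun j hj => hj.2)
  choose n hKn hn using hG
  refine ⟨n, hKn, fun O hO hKO => ?_⟩
  obtain ⟨j, hj, hjO⟩ := h K O hK hO hKO
  filter_upwards [eventually_ge_atTop j] with k hk
  exact ((hn k).trans (biInter_subset_of_mem ⟨hk, hj⟩)).trans hjO

/-- `C n` is the union of the compacts that `ψ` sends into `w n`. If the `w (n k)` shrink to `ψ L`
and `x k` lies in such a compact `F k`, then `ψ L` together with all `ψ (F k)` is compact, and its
image under `φ` contains every `F k`. -/
theorem TukeyGE.exists_countable_cover_of_compacts {M : Type*} {Y : Type*} [TopologicalSpace M]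
    [SecondCountableTopology M] [TopologicalSpace Y]
    (h : TukeyGE (CompactsPoset M) (CompactsPoset Y)) :
    ∃ C : ℕ → Set Y, ∀ L : Set Y, IsCompact L → ∃ n : ℕ → ℕ, (∀ k, L ⊆ C (n k)) ∧
      ∀ x : ℕ → Y, (∀ k, x k ∈ C (n k)) → ∃ L' : Set Y, IsCompact L' ∧ ∀ k, x k ∈ L' := by
  obtain ⟨φ, ψ, hφψ⟩ := tukeyGE_iff_exists.1 h
  obtain ⟨w, hw⟩ := exists_countable_nhdsSet_sequence (M := M)
  refine ⟨fun n => {y | ∃ L : Compacts Y, (ψ L : Set M) ⊆ w n ∧ y ∈ L}, fun L hL => ?_⟩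
  obtain ⟨n, hKn, hn⟩ := hw (ψ ⟨L, hL⟩) (ψ ⟨L, hL⟩).isCompact
  refine ⟨n, fun k y hy => ⟨⟨L, hL⟩, hKn k, hy⟩, fun x hx => ?_⟩
  choose F hF hxF using hx
  have hK := isCompact_union_iUnion (ψ ⟨L, hL⟩).isCompact (fun k => (ψ (F k)).isCompact)
    fun O hO hKO => (hn O hO hKO).mono fun k hk => (hF k).trans hk
  refine ⟨φ ⟨_, hK⟩, (φ _).isCompact, fun k => hφψ ⟨_, hK⟩ (F k) ?_ (hxF k)⟩
  exact (subset_iUnion (fun k => (ψ (F k) : Set M)) k).trans subset_union_right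

/-! ### Necessity: diagonalising against a countable cover -/

namespace Omega1

theorem exists_mem_Ioo_of_mem_closure {S : Set Omega1.{u}} {a c : Omega1.{u}}
    (hc : c ∈ closure S) (hcS : c ∉ S) (hac : a < c) : ∃ y ∈ S, a < y ∧ y < c := by
  obtain ⟨y, ⟨hay, hyc⟩, hyS⟩ :=
    mem_closure_iff.1 hc (Ioi a ∩ Iic c) (isOpen_Ioi.inter (isOpen_Iic c)) ⟨hac, self_mem_Iic⟩
  exact ⟨y, hyS, hay, hyc.lt_of_ne fun h => hcS (h ▸ hyS)⟩

theorem bddAbove_closure_diff_of_countable_cover {S : Set Omega1.{u}} {C : ℕ → Set Omega1.{u}}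
    (hCS : ∀ n, C n ⊆ S)
    (hC : ∀ L ⊆ S, IsCompact L → ∃ n : ℕ → ℕ, (∀ k, L ⊆ C (n k)) ∧
      ∀ x : ℕ → Omega1.{u}, (∀ k, x k ∈ C (n k)) → ∃ L' ⊆ S, IsCompact L' ∧ ∀ k, x k ∈ L') :
    BddAbove (closure S \ S) := by
  by_contra hE
  rw [not_bddAbove_iff] at hE
  -- `I n` collects the missing limit points of `S` that `C n` does not approach from below.
  set I : ℕ → Set Omega1.{u} := fun n =>
    {c | c ∈ closure S \ S ∧ ∃ a < c, ∀ x ∈ C n, x < c → x ≤ a} with hI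
  -- If every `C (n k)` accumulated at `c`, a choice of points cofinal in `c` would lie in a compact
  -- subset of `S`, forcing `c ∈ S`.
  have hIL : ∀ c ∈ closure S \ S, ∀ L ⊆ S, IsCompact L → ∃ n, L ⊆ C n ∧ c ∈ I n := by
    intro c hc L hLS hL
    obtain ⟨n, hLn, hn⟩ := hC L hLS hL
    by_contra! hcon
    have hx : ∀ (k : ℕ) (a : Iio c), ∃ x ∈ C (n k), x < c ∧ a.1 < x := by
      intro k a
      by_contra! hk
      exact hcon (n k) (hLn k) ⟨hc, a, a.2, hk⟩
    have hne : Nonempty (Iio c) := by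
      by_contra hemp
      refine hc.2 ?_
      obtain ⟨y, hyc, hyS⟩ := mem_closure_iff.1 hc.1 (Iic c) (isOpen_Iic c) self_mem_Iic
      exact (eq_of_le_of_not_lt (mem_Iic.1 hyc) fun h => hemp ⟨⟨y, h⟩⟩) ▸ hyS
    obtain ⟨e, he⟩ := exists_surjective_nat (Iio c)
    choose x hxC hxc hx using fun k => hx k (e k)
    obtain ⟨L', hL'S, hL', hxL'⟩ := hn x hxC
    refine hc.2 (hL'S (hL'.isClosed.closure_subset_iff.2 (range_subset_iff.2 hxL')
      (IsLUB.mem_closure ⟨?_, fun b hb => ?_⟩ (range_nonempty x))))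
    · rintro _ ⟨k, rfl⟩
      exact (hxc k).le
    · by_contra! hbc
      obtain ⟨k, hk⟩ := he ⟨b, hbc⟩
      exact (hb (mem_range_self k)).not_gt ((congrArg Subtype.val hk).symm.trans_lt (hx k))
  have bound : ∀ A : ℕ → Set Omega1.{u}, ∃ b, ∀ n, BddAbove (A n) → ∀ a ∈ A n, a < b := by
    intro A
    choose f hf using fun n : {n // BddAbove (A n)} => n.2
    obtain ⟨b, hb⟩ := exists_forall_lt f
    exact ⟨b, fun n hn a ha => (hf ⟨n, hn⟩ ha).trans_lt (hb ⟨n, hn⟩)⟩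
  have hg : ∀ a, ∃ b, a < b ∧ ∀ n, ¬ BddAbove (I n) → ∃ c ∈ I n, a < c ∧ c < b := by
    intro a
    choose f hfI hf using fun n : {n // ¬ BddAbove (I n)} => not_bddAbove_iff.1 n.2 a
    obtain ⟨b, hb⟩ := exists_forall_lt (fun o : Option {n // ¬ BddAbove (I n)} => o.elim a f)
    exact ⟨b, hb none, fun n hn => ⟨f ⟨n, hn⟩, hfI _, hf _, hb (some _)⟩⟩
  choose g hag hg using hg
  -- Any `s ∈ S` above the bounds of all bounded `C n` lies only in unbounded ones, so the sequence
  -- for `{s}` can climb past `g` at each stage; compactness puts its supremum in `S`.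
  obtain ⟨δ, hδS, x, hxmono, hxδ, hxS, hxg⟩ : ∃ δ ∈ S, ∃ x : ℕ → Omega1.{u},
      StrictMono x ∧ IsLUB (range x) δ ∧ (∀ k, x k ∈ S) ∧ ∀ k, g (x k) < x (k + 1) := by
    obtain ⟨b, hb⟩ := bound C
    obtain ⟨c, hc, hbc⟩ := hE b
    obtain ⟨s, hsS, hbs, -⟩ := exists_mem_Ioo_of_mem_closure hc.1 hc.2 hbc
    obtain ⟨n, hLn, hn⟩ := hC {s} (singleton_subset_iff.2 hsS) isCompact_singleton
    have hunb : ∀ k, ¬ BddAbove (C (n k)) := fun k hk =>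
      (hb _ hk s (hLn k rfl)).not_gt hbs
    choose f hfC hf using fun k => not_bddAbove_iff.1 (hunb k)
    let x : ℕ → Omega1.{u} := fun k => Nat.rec (f 0 b) (fun k a => f (k + 1) (g a)) k
    have hxg : ∀ k, g (x k) < x (k + 1) := fun k => hf _ _
    have hxC : ∀ k, x k ∈ C (n k) := fun k => by cases k <;> exact hfC _ _
    obtain ⟨d, hd⟩ := exists_forall_lt x
    obtain ⟨δ, hδ⟩ := exists_isLUB (range x) ⟨d, by rintro _ ⟨k, rfl⟩; exact (hd k).le⟩
    obtain ⟨L', hL'S, hL', hxL'⟩ := hn x hxC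
    exact ⟨δ, hL'S (hL'.isClosed.closure_subset_iff.2 (range_subset_iff.2 hxL')
      (hδ.mem_closure (range_nonempty x))), x,
      strictMono_nat_of_lt_succ fun k => (hag _).trans (hxg k), hδ, fun k => hCS _ (hxC k), hxg⟩
  -- If `I n` is unbounded, `g` provides `c ∈ I n` between `x n` and `x (n + 1)`; near `c` there are
  -- points of `S` but none of `C n`.
  have hy : ∀ n, ∃ y ∈ S, x n ≤ y ∧ y ≤ δ ∧ (¬ BddAbove (I n) → y ∉ C n) := by
    intro n
    by_cases hn : BddAbove (I n)
    · exact ⟨x n, hxS n, le_rfl, hxδ.1 (mem_range_self n), fun h => (h hn).elim⟩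
    · obtain ⟨c, ⟨hcE, a, hac, ha⟩, hxc, hcg⟩ := hg (x n) n hn
      obtain ⟨y, hyS, hy, hyc⟩ := exists_mem_Ioo_of_mem_closure hcE.1 hcE.2 (max_lt hac hxc)
      exact ⟨y, hyS, ((le_max_right _ _).trans_lt hy).le,
        (hyc.trans (hcg.trans (hxg n))).le.trans (hxδ.1 (mem_range_self _)),
        fun _ hyC => (ha y hyC hyc).not_gt ((le_max_left _ _).trans_lt hy)⟩
  choose y hyS hxy hyδ hyC using hy
  have hlim : Tendsto y atTop (𝓝 δ) :=
    tendsto_of_tendsto_of_tendsto_of_le_of_le (tendsto_atTop_isLUB hxmono.monotone hxδ)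
      tendsto_const_nhds hxy hyδ
  -- A `c` above the bounds of all bounded `I n` can lie only in an unbounded one, where `y n`
  -- avoids `C n`.
  obtain ⟨b, hb⟩ := bound I
  obtain ⟨c, hc, hbc⟩ := hE b
  obtain ⟨n, hLn, hcn⟩ := hIL c hc (insert δ (range y))
    (insert_subset hδS (range_subset_iff.2 hyS)) hlim.isCompact_insert_range
  exact hyC n (fun h => (hb n h c hcn).not_gt hbc) (hLn (mem_insert_of_mem _ (mem_range_self n)))

theorem bddAbove_closure_diff_of_tukeyGE {M : Type*} [TopologicalSpace M]
    [SecondCountableTopology M] {S : Set Omega1.{u}}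
    (h : TukeyGE (CompactsPoset M) (CompactsPoset S)) : BddAbove (closure S \ S) := by
  obtain ⟨C, hC⟩ := h.exists_countable_cover_of_compacts
  refine bddAbove_closure_diff_of_countable_cover (C := fun n => (↑) '' C n)
    (fun n => by rintro _ ⟨x, -, rfl⟩; exact x.2) fun L hLS hL => ?_
  have hL' : IsCompact ((↑) ⁻¹' L : Set S) :=
    Topology.IsInducing.subtypeVal.isCompact_preimage' hL (by simpa using hLS)
  obtain ⟨n, hLn, hn⟩ := hC _ hL'
  refine ⟨n, fun k x hx => ⟨⟨x, hLS hx⟩, hLn k hx, rfl⟩, fun x hx => ?_⟩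
  choose z hz hzx using hx
  obtain ⟨L', hL', hzL'⟩ := hn z hz
  refine ⟨(↑) '' L', by rintro _ ⟨x, -, rfl⟩; exact x.2, hL'.image continuous_subtype_val,
    fun k => ⟨z k, hzL' k, hzx k⟩⟩

end Omega1

/-! ### A separable metrizable space whose compacts dominate `ω₁` -/

/-- The space of well-ordered sets of rationals, a subspace of the Cantor cube `ℚ → Bool`. -/
abbrev WellOrderedRatSets : Type :=
  {A : ℚ → Bool // {q | A q = true}.IsWF}

namespace WellOrderedRatSets

/-- Extension of a strictly decreasing list of rationals, contained in a member of `K`, by a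
smaller rational. -/
def Extends (K : Set WellOrderedRatSets) (l' l : List ℚ) : Prop :=
  ∃ q, l' = q :: l ∧ l'.Pairwise (· < ·) ∧ ∃ A ∈ K, ∀ p ∈ l', A.1 p = true

/-- An infinite chain gives a decreasing sequence of rationals whose finite parts lie in members of
`K`; by compactness one member contains it all, contradicting well-ordering. -/
theorem wellFounded_extends {K : Set WellOrderedRatSets} (hK : IsCompact K) :
    WellFounded (Extends K) := by
  rw [wellFounded_iff_isEmpty_descending_chain]
  refine ⟨fun ⟨f, hf⟩ => ?_⟩
  choose q hq hsort A hAK hA using hf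
  have hmem : ∀ m n, m < n → q m ∈ f n := by
    intro m n hmn
    induction n, hmn using Nat.le_induction with
    | base => simp [hq]
    | succ n _ ih => rw [hq]; exact List.mem_cons_of_mem _ ih
  have hanti : StrictAnti q := strictAnti_nat_of_succ_lt fun n => by
    have h := hsort (n + 1)
    rw [hq (n + 1)] at h
    exact (List.pairwise_cons.1 h).1 _ (hmem _ _ n.lt_succ_self)
  have hcl : ∀ p : ℚ, IsClosed {A : WellOrderedRatSets | A.1 p = true} := fun p =>
    isClosed_eq ((continuous_apply p).comp continuous_subtype_val) continuous_const
  obtain ⟨B, -, hB⟩ := hK.inter_iInter_nonempty _ (fun n => hcl (q n)) fun t => by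
    obtain ⟨N, hN⟩ := t.exists_nat_subset_range
    exact ⟨A N, hAK N, mem_iInter₂.2 fun n hn => hA N _ <|
      hmem n _ ((Finset.mem_range.1 (hN hn)).trans N.lt_succ_self)⟩
  rw [mem_iInter] at hB
  exact Set.isWF_iff_no_descending_seq.1 B.2 q hanti hB

/-- Countability of `α` lets the recursive strict bounds stay below `ω₁`. -/
theorem exists_rank {α : Type*} [Countable α] {r : α → α → Prop} (hr : WellFounded r) :
    ∃ ρ : α → Omega1.{u}, ∀ a b, r a b → ρ a < ρ b := by
  refine ⟨hr.fix (C := fun _ => Omega1.{u}) fun b ih => Classical.choose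
    (Omega1.exists_forall_lt fun a : {a // r a b} => ih a.1 a.2), fun a b hab => ?_⟩
  rw [hr.fix_eq _ b]
  exact Classical.choose_spec
    (Omega1.exists_forall_lt fun a : {a // r a b} => hr.fix (C := fun _ => Omega1.{u}) _ a.1) ⟨a, hab⟩

theorem exists_initialSegment_code (a : Omega1.{u}) :
    ∃ (A : WellOrderedRatSets) (f : Iio a → ℚ), StrictMono f ∧ ∀ b, A.1 (f b) = true := by
  classical
  obtain ⟨f⟩ := Order.embedding_from_countable_to_dense (Iio a) ℚ
  refine ⟨⟨fun q => decide (q ∈ range f), ?_⟩, f, f.strictMono, fun b => by simp⟩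
  simp only [decide_eq_true_eq]
  rw [Set.isWF_iff_no_descending_seq]
  intro s hs hsf
  choose t ht using hsf
  have : StrictAnti t := fun m n hmn => f.lt_iff_lt.1 (by rw [ht, ht]; exact hs hmn)
  exact (RelEmbedding.natGT t fun n => this n.lt_succ_self).not_wellFounded wellFounded_lt

/-- The compact subsets of `WellOrderedRatSets` have bounded order types. -/
theorem exists_bddAbove_of_isCompact : ∃ x : Omega1.{u} → WellOrderedRatSets,
    ∀ K : Set WellOrderedRatSets, IsCompact K → BddAbove {a | x a ∈ K} := by
  choose x f hf hx using exists_initialSegment_code.{u}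
  refine ⟨x, fun K hK => ?_⟩
  obtain ⟨ρ, hρ⟩ := exists_rank.{u} (wellFounded_extends hK)
  refine ⟨ρ [], fun a ha => ?_⟩
  -- Prepending codes of smaller ordinals extends the list, so the rank of a list headed by the code
  -- of `b` is at least `b`; hence `ρ []` bounds `a`.
  have key : ∀ b : Iio a, ∀ l, Extends K (f a b :: l) l → (∀ p ∈ l, (x a).1 p = true) →
      b.1 ≤ ρ (f a b :: l) := by
    intro b
    induction b using WellFoundedLT.induction with
    | ind b ih =>
      intro l hl hlA
      refine le_of_forall_lt fun c hc => ?_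
      have hA : ∀ p ∈ f a b :: l, (x a).1 p = true := by
        simpa [hx] using hlA
      have hcb : f a ⟨c, hc.trans b.2⟩ < f a b := hf a hc
      have hsort : (f a b :: l).Pairwise (· < ·) := by
        obtain ⟨q, -, h, -⟩ := hl
        exact h
      have hext : Extends K (f a ⟨c, hc.trans b.2⟩ :: f a b :: l) (f a b :: l) := by
        refine ⟨_, rfl, List.pairwise_cons.2 ⟨fun p hp => ?_, hsort⟩, x a, ha, ?_⟩
        · rcases List.mem_cons.1 hp with rfl | hp
          · exact hcb
          · exact hcb.trans ((List.pairwise_cons.1 hsort).1 p hp)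
        · simpa [hx] using hlA
      exact (ih ⟨c, hc.trans b.2⟩ hc _ hext hA).trans_lt (hρ _ _ hext)
  refine le_of_forall_lt fun b hb => ?_
  have hext : Extends K [f a ⟨b, hb⟩] [] :=
    ⟨_, rfl, List.pairwise_singleton _ _, x a, ha, by simp [hx]⟩
  exact (key ⟨b, hb⟩ [] hext (by simp)).trans_lt (hρ _ _ hext)

end WellOrderedRatSets

/-! ### Sufficiency: the witnessing space -/

theorem metrizableSpace_sum {X Y : Type*} [TopologicalSpace X] [TopologicalSpace Y]
    [MetrizableSpace X] [MetrizableSpace Y] : MetrizableSpace (X ⊕ Y) := by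
  let := metrizableSpaceMetric X
  let := metrizableSpaceMetric Y
  let := Metric.metricSpaceSum (X := X) (Y := Y)
  infer_instance

theorem secondCountableTopology_of_countable_linearOrder (X : Type*) [LinearOrder X]
    [TopologicalSpace X] [OrderTopology X] [Countable X] : SecondCountableTopology X := by
  refine ⟨⟨_, ?_, OrderTopology.topology_eq_generate_intervals⟩⟩
  refine ((countable_range (Ioi : X → Set X)).union (countable_range (Iio : X → Set X))).mono ?_
  rintro _ ⟨a, rfl | rfl⟩
  · exact .inl (mem_range_self a)
  · exact .inr (mem_range_self a)

namespace Omega1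

theorem exists_tukeyGE_of_bddAbove {S : Set Omega1.{u}} (hS : BddAbove (closure S \ S)) :
    ∃ (M : Type v) (_ : TopologicalSpace M),
      MetrizableSpace M ∧ SeparableSpace M ∧ TukeyGE (CompactsPoset M) (CompactsPoset S) := by
  obtain ⟨α, hα⟩ := hS
  obtain ⟨x, hx⟩ := WellOrderedRatSets.exists_bddAbove_of_isCompact.{u}
  have := secondCountableTopology_of_countable_linearOrder (Iic α)
  let N : Type (u + 1) := {y : Iic α // y.1 ∈ S}
  have : MetrizableSpace N :=
    IsEmbedding.subtypeVal.metrizableSpace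
  have : SecondCountableTopology N := IsEmbedding.subtypeVal.secondCountableTopology
  have : MetrizableSpace WellOrderedRatSets := IsEmbedding.subtypeVal.metrizableSpace
  have : SecondCountableTopology WellOrderedRatSets :=
    IsEmbedding.subtypeVal.secondCountableTopology
  have hval : IsInducing fun n : N => n.1.1 :=
    IsInducing.subtypeVal.comp (IsInducing.subtypeVal (t := fun y : Iic α => y.1 ∈ S))
  -- `N` is countable, hence small in every universe.
  let e : N ≃ₜ Shrink.{v} N := Shrink.homeomorph.{v} N
  let b : WellOrderedRatSets ≃ₜ ULift.{v} WellOrderedRatSets := Homeomorph.ulift.symm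
  have : MetrizableSpace (Shrink.{v} N) := e.symm.isEmbedding.metrizableSpace
  have : SecondCountableTopology (Shrink.{v} N) := e.symm.isEmbedding.secondCountableTopology
  have : MetrizableSpace (ULift.{v} WellOrderedRatSets) := b.symm.isEmbedding.metrizableSpace
  have : SecondCountableTopology (ULift.{v} WellOrderedRatSets) :=
    b.symm.isEmbedding.secondCountableTopology
  refine ⟨Shrink.{v} N ⊕ ULift.{v} WellOrderedRatSets, inferInstance, metrizableSpace_sum,
    inferInstance, tukeyGE_iff_exists.2 ?_⟩
  have hφ : ∀ K : Compacts (Shrink.{v} N ⊕ ULift.{v} WellOrderedRatSets), ∃ L : Compacts S,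
      ∀ s : S, (∀ hs : s.1 ≤ α, Sum.inl (e ⟨⟨s.1, hs⟩, s.2⟩) ∈ K) →
        (∃ c, s.1 ≤ c ∧ Sum.inr (b (x c)) ∈ K) → s ∈ L := by
    intro K
    have h1 : IsCompact ((fun n : N => Sum.inl (e n)) ⁻¹' (K : Set (Shrink.{v} N ⊕ ULift.{v} WellOrderedRatSets))) :=
      (IsClosedEmbedding.inl.comp e.isClosedEmbedding).isCompact_preimage K.isCompact
    have h2 : IsCompact ((fun n => Sum.inr (b n)) ⁻¹' (K : Set (Shrink.{v} N ⊕ ULift.{v} WellOrderedRatSets))) :=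
      (IsClosedEmbedding.inr.comp b.isClosedEmbedding).isCompact_preimage K.isCompact
    obtain ⟨d, hd⟩ := hx _ h2
    have hcont : Continuous fun n : N => (⟨n.1.1, n.2⟩ : S) :=
      hval.continuous.subtype_mk _
    -- Past `α` the closure adds no points to `S`, so a bounded piece is a closed subset of the
    -- compact `Iic d`.
    have h3 : IsCompact ((↑) ⁻¹' (closure S ∩ {y | α < y} ∩ Iic d) : Set S) := by
      refine IsInducing.subtypeVal.isCompact_preimage' ?_ ?_
      · refine (isCompact_Iic d).inter_left (isClosed_closure.inter ?_)
        rw [show {y | α < y} = (Iic α)ᶜ from compl_Iic.symm]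
        exact (isOpen_Iic α).isClosed_compl
      · rintro y ⟨⟨hy, hαy⟩, -⟩
        by_contra hyS
        exact (hα ⟨hy, by simpa using hyS⟩).not_gt hαy
    refine ⟨⟨_, (h1.image hcont).union h3⟩, fun s hs ⟨c, hsc, hc⟩ => ?_⟩
    rcases le_or_gt s.1 α with hsα | hsα
    · exact .inl ⟨⟨⟨s.1, hsα⟩, s.2⟩, hs hsα, rfl⟩
    · exact .inr ⟨⟨subset_closure s.2, hsα⟩, hsc.trans (hd hc)⟩
  choose φ hφ using hφ
  have hψ : ∀ L : Compacts S, ∃ K : Compacts (Shrink.{v} N ⊕ ULift.{v} WellOrderedRatSets),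
      ∀ s ∈ L, (∀ hs : s.1 ≤ α, Sum.inl (e ⟨⟨s.1, hs⟩, s.2⟩) ∈ K) ∧
        (∃ c, s.1 ≤ c ∧ Sum.inr (b (x c)) ∈ K) := by
    intro L
    let f : N → S := fun n => ⟨n.1.1, n.2⟩
    have hf : IsInducing f := 
      .of_comp (hval.continuous.subtype_mk _) continuous_subtype_val hval
    have hL : IsCompact (f ⁻¹' ((L : Set S) ∩ {s | s.1 ≤ α})) :=
      hf.isCompact_preimage' (L.isCompact.inter_right (isClosed_le (by fun_prop) (by fun_prop)))
        fun s hs => ⟨⟨⟨s.1, hs.2⟩, s.2⟩, rfl⟩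
    obtain ⟨c, hc⟩ := (L.isCompact.image continuous_subtype_val).bddAbove
    refine ⟨⟨_, (hL.image (continuous_inl.comp e.continuous)).union
      (isCompact_singleton (x := Sum.inr (b (x c))))⟩, fun s hs => ⟨fun hsα => ?_, c, ?_, ?_⟩⟩
    · exact .inl ⟨⟨⟨s.1, hsα⟩, s.2⟩, ⟨hs, hsα⟩, rfl⟩
    · exact hc (mem_image_of_mem _ hs)
    · exact .inr rfl
  choose ψ hψ using hψ
  exact ⟨φ, ψ, fun K L hLK s hs => hφ K s (fun h => hLK ((hψ L s hs).1 h))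
    ((hψ L s hs).2.imp fun c hc => ⟨hc.1, hLK hc.2⟩)⟩

end Omega1

theorem mainTheorem3 (S : Set Omega1.{u}) :
    (∃ (M : Type v) (_ : TopologicalSpace M),
      MetrizableSpace M ∧ SeparableSpace M ∧ TukeyGE (CompactsPoset M) (CompactsPoset S)) ↔
    BddAbove (closure S \ S) := by
  refine ⟨?_, Omega1.exists_tukeyGE_of_bddAbove⟩
  rintro ⟨M, _, _, _, h⟩
  let := metrizableSpaceMetric M
  have : SecondCountableTopology M := UniformSpace.secondCountable_of_separable M
  exact Omega1.bddAbove_closure_diff_of_tukeyGE h
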